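/- **Setting.** Let $Q$ be a finite-dimensional $C^\infty$ Riemannian manifold without boundary, with Riemannian distance $d$, and let $k,r\in\mathbb N\cup\{\infty\}$ with $0\le k$ and $k+1\le r$. Let $\Phi:\mathbb R\times Q\to Q$ be a (complete) $C^r$ flow. A compact *$1$-normally attracting invariant manifold* ($1$-NAIM) is a compact embedded $C^1$ submanifold $M\subset Q$ without boundary with $\Phi^t(M)=M$ for all $t\in\mathbb R$, together with a $\mathsf D\Phi^t$-invariant continuous splitting $\mathsf TQ|_M=\mathsf TM\oplus E^s$ and constants $C>0$, $a<0$ such that for all $m\in M$, $t\ge 0$ and $i\in\{0,1\}$ $$\|\mathsf D\Phi^t|_{E^s_m}\|\le C e^{at}\Bigl(\inf_{w\in \mathsf T_mM,\ \|w\|=1}\|\mathsf D\Phi^t w\|\Bigr)^i .$$ The global stable manifold $W^s(M)$ is the basin of attraction of $M$, i.e. the set of $x\in Q$ with $\Phi^t(x)\to M$ as $t\to\infty$; its stable foliation has the leaves $W^s(m)$, $m\in M$, where $W^s(m)$ is the set of $x\in W^s(M)$ with $d(\Phi^t x,\Phi^t m)=o\bigl(d(\Phi^t x,\Phi^t m')\bigr)$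 as $t\to\infty$ for every $m'\in M\setminus\{m\}$. A $C^k$ isomorphism is a $C^k$ diffeomorphism if $k\ge1$ and a homeomorphism if $k=0$. A $C^k$ isomorphism $\varphi$ from a subset $U\subseteq W^s(M)$ onto a subset of $E^s$ is *fiber-preserving*, covering $\rho:M\to M$, if for all $x\in U$ and $m\in M$ one has $x\in W^s(m)$ if and only if $\varphi(x)\in E^s_{\rho(m)}$, that is, if it maps $U\cap W^s(m)$ bijectively onto $\varphi(U)\cap E^s_{\rho(m)}$ and different leaves into different fibers. (The usual case is $\rho=\mathrm{id}_M$.) **Theorem.** Let $M\subset Q$ be a compact (boundaryless) $1$-NAIM for the $C^r$ flow $\Phi^t$. Assume that $E^s$ is of class $C^k$ (a $C^k$ subbundle of $\mathsf TQ|_M$ over the $C^k$ submanifold $M$), and that $\Phi^t$ is $C^k$ conjugate to the linear flow $\mathsf D\Phi^t|_{E^s}$ near $M$: there are a neighborhood $U\subseteq W^s(M)$ of $M$ and a fiber-preserving $C^k$ isomorphism $\varphi_{\mathrm{loc}}$, covering some $\rho:M\to M$, from $U$ onto a neighborhood of the zero section in $E^s$, such that $\varphi_{\mathrm{loc}}(\Phi^t(x))=\mathsf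 D\Phi^t(\varphi_{\mathrm{loc}}(x))$ whenever $t\in\mathbb R$, $x\in U$ and $\Phi^t(x)\in U$. Then there is a $C^k$ fiber-preserving isomorphism $\varphi:W^s(M)\to E^s$ onto all of $E^s$, covering the same $\rho$, such that $$\forall t\in\mathbb R:\quad \varphi\circ\Phi^t=\mathsf D\Phi^t|_{E^s}\circ\varphi ,$$ and $\varphi$ agrees with $\varphi_{\mathrm{loc}}$ on $U$. -/

import Mathlib

open Set Filter Topology Manifold Bundle
open scoped ContDiff NNReal ENNReal

namespace NAIM

/-- `S` is an embedded (boundaryless) `C^k` submanifold of dimension `d` of the `n`-dimensional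
manifold `Q`: around each of its points there is a `C^k` chart of `Q` in which `S` is a
`d`-dimensional linear subspace. -/
def IsSubmanifold {n : ℕ} {Q : Type*} [TopologicalSpace Q]
    [ChartedSpace (EuclideanSpace ℝ (Fin n)) Q] (k : ℕ∞) (d : ℕ) (S : Set Q) : Prop :=
  ∀ x ∈ S, ∃ e ∈ IsManifold.maximalAtlas (𝓡 n) (k : WithTop ℕ∞) Q, x ∈ e.source ∧
    ∃ F : Submodule ℝ (EuclideanSpace ℝ (Fin n)), Module.finrank ℝ F = d ∧
      ∀ y ∈ e.source, y ∈ S ↔ e y ∈ F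

/-- The tangent space `T_x S` of a subset `S ⊆ Q`, spanned by the velocities at `x` of the curves
in `S` through `x` (for a `C^1` submanifold these velocities already form a subspace). -/
noncomputable def tangentSpaceOf {n : ℕ} {Q : Type*} [TopologicalSpace Q]
    [ChartedSpace (EuclideanSpace ℝ (Fin n)) Q] [IsManifold (𝓡 n) ∞ Q] (S : Set Q) (x : Q) :
    Submodule ℝ (TangentSpace (𝓡 n) x) :=
  Submodule.span ℝ {v | ∃ γ : ℝ → Q, (∀ᶠ t in 𝓝 (0 : ℝ), γ t ∈ S) ∧
    MDifferentiableAt 𝓘(ℝ, ℝ) (𝓡 n) γ 0 ∧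
    tangentMap 𝓘(ℝ, ℝ) (𝓡 n) γ (⟨0, (1 : ℝ)⟩ : TangentBundle 𝓘(ℝ, ℝ) ℝ) =
      (⟨x, v⟩ : TangentBundle (𝓡 n) Q)}

/-- The family of subspaces `E m ⊆ T_m Q`, `m ∈ M`, is a `C^k` vector subbundle of `TQ|_M`: the
set `M` is a `C^k` submanifold and, near each point of `M`, there is a local frame of `E`
consisting of `C^k` sections over `M`. The values of `E` outside `M` are irrelevant. -/
def IsSubbundle {n : ℕ} {Q : Type*} [TopologicalSpace Q]
    [ChartedSpace (EuclideanSpace ℝ (Fin n)) Q] [IsManifold (𝓡 n) ∞ Q] (k : ℕ∞) (M : Set Q)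
    (E : (q : Q) → Submodule ℝ (TangentSpace (𝓡 n) q)) : Prop :=
  (∃ d, IsSubmanifold (n := n) k d M) ∧
  ∀ m ∈ M, ∃ V ∈ 𝓝 m, ∃ (l : ℕ) (σ : Fin l → (q : Q) → TangentSpace (𝓡 n) q),
    (∀ i, ContMDiffOn (𝓡 n) (𝓡 n).tangent (k : WithTop ℕ∞)
      (fun q ↦ (⟨q, σ i q⟩ : TangentBundle (𝓡 n) Q)) (V ∩ M)) ∧
    ∀ q ∈ V ∩ M, LinearIndependent ℝ (fun i ↦ σ i q) ∧
      Submodule.span ℝ (range fun i ↦ σ i q) = E q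

/-- The total space of a subbundle `E` of `TQ|_M`, as a subset of `TQ`. -/
def totalSet {n : ℕ} {Q : Type*} [TopologicalSpace Q]
    [ChartedSpace (EuclideanSpace ℝ (Fin n)) Q] [IsManifold (𝓡 n) ∞ Q] (M : Set Q)
    (E : (q : Q) → Submodule ℝ (TangentSpace (𝓡 n) q)) : Set (TangentBundle (𝓡 n) Q) :=
  {p | p.1 ∈ M ∧ p.2 ∈ E p.1}

/-- The zero section over `M`, as a subset of `TQ`. -/
def zeroSectionOver {n : ℕ} {Q : Type*} [TopologicalSpace Q]
    [ChartedSpace (EuclideanSpace ℝ (Fin n)) Q] [IsManifold (𝓡 n) ∞ Q] (M : Set Q) :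
    Set (TangentBundle (𝓡 n) Q) :=
  {p | p.1 ∈ M ∧ p.2 = 0}

/-- `M` is a compact boundaryless `r`-normally attracting invariant manifold of dimension `d` for
the flow `Φ`, with invariant splitting `TQ|_M = TM ⊕ E^s`.

The rate condition says `‖DΦ^t|_{E^s_m}‖ ≤ C e^{at} (inf_{w ∈ T_m M, ‖w‖ = 1} ‖DΦ^t w‖)^i` for
`0 ≤ i ≤ r`, written out on vectors. -/
structure IsNAIM {n : ℕ} {Q : Type*} [EMetricSpace Q]
    [ChartedSpace (EuclideanSpace ℝ (Fin n)) Q] [IsManifold (𝓡 n) ∞ Q]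
    [RiemannianBundle (fun q : Q ↦ TangentSpace (𝓡 n) q)]
    (r : ℕ) (d : ℕ) (Φ : Flow ℝ Q) (M : Set Q)
    (Es : (q : Q) → Submodule ℝ (TangentSpace (𝓡 n) q)) : Prop where
  isCompact : IsCompact M
  isSubmanifold : IsSubmanifold (n := n) 1 d M
  invariant : ∀ t : ℝ, ∀ m ∈ M, Φ t m ∈ M
  continuous_bundle : IsSubbundle 0 M Es
  isCompl : ∀ m ∈ M, IsCompl (tangentSpaceOf M m) (Es m)
  bundle_invariant : ∀ t : ℝ, ∀ m ∈ M, ∀ v ∈ Es m, mfderiv (𝓡 n) (𝓡 n) (Φ t) m v ∈ Es (Φ t m)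
  rates : ∃ C > (0 : ℝ), ∃ a < (0 : ℝ), ∀ i ≤ r, ∀ t ≥ (0 : ℝ), ∀ m ∈ M,
    ∀ v ∈ Es m, ∀ w ∈ tangentSpaceOf M m,
      ‖mfderiv (𝓡 n) (𝓡 n) (Φ t) m v‖ * ‖w‖ ^ i ≤
        C * Real.exp (a * t) * ‖mfderiv (𝓡 n) (𝓡 n) (Φ t) m w‖ ^ i * ‖v‖

/-- The global stable manifold `W^s(M)` of a compact boundaryless attracting `M`: its basin of
attraction. -/
def stableManifold {Q : Type*} [TopologicalSpace Q] (Φ : Flow ℝ Q) (M : Set Q) : Set Q :=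
  {x | Tendsto (fun t : ℝ ↦ Φ t x) atTop (𝓝ˢ M)}

/-- The leaf `W^s(m)` of the global stable foliation of `M`: the points `x` of the basin whose
orbit is asymptotic to the orbit of `m` faster than to the orbit of any other point of `M`, that
is, `d(Φ^t x, Φ^t m) = o(d(Φ^t x, Φ^t m'))` as `t → ∞` for all `m' ∈ M`, `m' ≠ m`. -/
def stableLeaf {Q : Type*} [EMetricSpace Q] (Φ : Flow ℝ Q) (M : Set Q) (m : Q) : Set Q :=
  {x | x ∈ stableManifold Φ M ∧ ∀ m' ∈ M, m' ≠ m → ∀ ε : ℝ≥0, 0 < ε →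
    ∀ᶠ t : ℝ in atTop, edist (Φ t x) (Φ t m) ≤ ε * edist (Φ t x) (Φ t m')}

/-- A partial bijection `φ` between subsets of `Q` and of `TQ` is a fiber-preserving `C^k`
isomorphism (diffeomorphism, or homeomorphism if `k = 0`) from `φ.source ⊆ W^s(M)` onto
`φ.target ⊆ E^s`, covering `ρ : M → M`, and it conjugates `Φ^t` with `DΦ^t|_{E^s}` wherever both
`x` and `Φ^t x` lie in `φ.source`. -/
structure IsLinearizingConjugacy {n : ℕ} {Q : Type*} [EMetricSpace Q]
    [ChartedSpace (EuclideanSpace ℝ (Fin n)) Q] [IsManifold (𝓡 n) ∞ Q]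
    (k : ℕ∞) (Φ : Flow ℝ Q) (M : Set Q)
    (Es : (q : Q) → Submodule ℝ (TangentSpace (𝓡 n) q)) (ρ : Q → Q)
    (φ : PartialEquiv Q (TangentBundle (𝓡 n) Q)) : Prop where
  source_subset : φ.source ⊆ stableManifold Φ M
  target_subset : φ.target ⊆ totalSet M Es
  contMDiffOn : ContMDiffOn (𝓡 n) (𝓡 n).tangent (k : WithTop ℕ∞) φ φ.source
  contMDiffOn_symm : ContMDiffOn (𝓡 n).tangent (𝓡 n) (k : WithTop ℕ∞) φ.symm φ.target
  fiber_preserving : ∀ m ∈ M, ∀ x ∈ φ.source, x ∈ stableLeaf Φ M m ↔ (φ x).1 = ρ m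
  conjugates : ∀ (t : ℝ), ∀ x ∈ φ.source, Φ t x ∈ φ.source →
    φ (Φ t x) = tangentMap (𝓡 n) (𝓡 n) (Φ t) (φ x)

end NAIM

/-!
The local conjugacy is spread over the whole basin by the flow: for `x ∈ W^s(M)` put
`φ x = DΦ^{-t} (φloc (Φ^t x))`, where `t` is any time with `Φ^t x` in the domain `U` of `φloc`.
Such `t` exist because `U` is a neighbourhood of `M`, and two choices give the same value because
`φloc` conjugates the flows between any two points of `U` on one orbit. The resulting map is
equivariant, and injective since any two points of the basin lie in `U` at a common late time.
It is onto `E^s` because the linear flow contracts `E^s` to the zero section, hence into the range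
of `φloc`; the contraction is the case `i = 0` of the rate condition, turned into topological
convergence by compactness of `M` (`exists_forall_norm_lt_mem_of_mem_nhdsSet_zeroSectionOver`).
This part is purely set-theoretic and is done for `IsLocalConjugacy`.

Smoothness is local: near a given point a single time `t` can be used in the formula for `φ`
(or for its inverse), and `Φ^t` and `DΦ^t` are of class `C^k` because `k + 1 ≤ r`.

For the fibers, each `m ∈ M` lies in its own leaf, so `φloc m` lies over `ρ m` and equivariance of
`φloc` makes `ρ` commute with the flow on `M`. As the flow also permutes the leaves
(`apply_mem_stableLeaf_iff`), the fiber condition for `φ` at `x` is that for `φloc` at `Φ^t x`.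
-/

namespace NAIM

/-! ### Globalizing a local conjugacy of two actions of `ℝ` -/

section Globalize

variable {X Y : Type*} {S : ℝ → X → X} {T : ℝ → Y → Y} {A : Set X} {B : Set Y}
  {e : PartialEquiv X Y}

open Classical in
/-- The extension of `f`, meaningful on `U`, along the actions `S` and `T` of `ℝ`: it sends `x` to
`T (-t) (f (S t x))` for a chosen time `t` with `S t x ∈ U`. If there is no such time, the value is
that for `t = 0`. -/
noncomputable def extendAlong (S : ℝ → X → X) (T : ℝ → Y → Y) (f : X → Y) (U : Set X) (x : X) : Y :=
  let t : ℝ := if h : ∃ t, S t x ∈ U then h.choose else 0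
  T (-t) (f (S t x))

lemma exists_extendAlong_eq {f : X → Y} {U : Set X} {x : X} (h : ∃ t, S t x ∈ U) :
    ∃ t, S t x ∈ U ∧ extendAlong S T f U x = T (-t) (f (S t x)) :=
  ⟨h.choose, h.choose_spec, by simp only [extendAlong, dif_pos h]⟩

/-- The partial bijection `e` conjugates the actions `S` and `T` of `ℝ` between any two points of
an orbit that lie in its source. Its source lies in the invariant set `A` and absorbs all orbits
there; its target does the same in `B`. -/
structure IsLocalConjugacy (S : ℝ → X → X) (T : ℝ → Y → Y) (A : Set X) (B : Set Y)
    (e : PartialEquiv X Y) : Prop where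
  left_zero : ∀ x, S 0 x = x
  left_add : ∀ s t x, S (s + t) x = S s (S t x)
  right_zero : ∀ y, T 0 y = y
  right_add : ∀ s t y, T (s + t) y = T s (T t y)
  source_subset : e.source ⊆ A
  target_subset : e.target ⊆ B
  left_mem : ∀ t, ∀ x ∈ A, S t x ∈ A
  right_mem : ∀ t, ∀ y ∈ B, T t y ∈ B
  left_absorbed : ∀ x ∈ A, ∀ᶠ t in atTop, S t x ∈ e.source
  right_absorbed : ∀ y ∈ B, ∀ᶠ t in atTop, T t y ∈ e.target
  conj : ∀ t, ∀ x ∈ e.source, S t x ∈ e.source → e (S t x) = T t (e x)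

namespace IsLocalConjugacy

lemma left_neg_cancel (h : IsLocalConjugacy S T A B e) (t : ℝ) (x : X) : S (-t) (S t x) = x := by
  rw [← h.left_add, neg_add_cancel, h.left_zero]

lemma right_neg_cancel (h : IsLocalConjugacy S T A B e) (t : ℝ) (y : Y) : T (-t) (T t y) = y := by
  rw [← h.right_add, neg_add_cancel, h.right_zero]

/-- Any time at which the orbit is in the source of `e` computes the extension. -/
lemma extendAlong_eq (h : IsLocalConjugacy S T A B e) {x : X} {t : ℝ} (ht : S t x ∈ e.source) :
    extendAlong S T e e.source x = T (-t) (e (S t x)) := by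
  obtain ⟨s, hs, hx⟩ := exists_extendAlong_eq (T := T) (f := e) ⟨t, ht⟩
  have hst : S (t - s) (S s x) = S t x := by rw [← h.left_add, sub_add_cancel]
  have key := h.conj (t - s) (S s x) hs (hst ▸ ht)
  rw [hx, ← hst, key, ← h.right_add]
  congr 1
  ring

lemma extendAlong_eq_self (h : IsLocalConjugacy S T A B e) {x : X} (hx : x ∈ e.source) :
    extendAlong S T e e.source x = e x := by
  have hx' : S 0 x ∈ e.source := by rwa [h.left_zero]
  rw [h.extendAlong_eq hx', neg_zero, h.right_zero, h.left_zero]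

lemma extendAlong_apply (h : IsLocalConjugacy S T A B e) (s : ℝ) {x : X} (hx : x ∈ A) :
    extendAlong S T e e.source (S s x) = T s (extendAlong S T e e.source x) := by
  obtain ⟨t, ht⟩ := (h.left_absorbed _ (h.left_mem s x hx)).exists
  have ht' : S (t + s) x ∈ e.source := by rwa [h.left_add]
  rw [h.extendAlong_eq ht, h.extendAlong_eq ht', ← h.right_add, ← h.left_add]
  congr 1
  ring

lemma extendAlong_mem (h : IsLocalConjugacy S T A B e) {x : X} (hx : x ∈ A) :
    extendAlong S T e e.source x ∈ B := by
  obtain ⟨t, ht⟩ := (h.left_absorbed x hx).exists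
  rw [h.extendAlong_eq ht]
  exact h.right_mem _ _ (h.target_subset (e.map_source ht))

/-- Two points of `A` are in the source of `e` at a common time, where `e` separates them. -/
lemma injOn_extendAlong (h : IsLocalConjugacy S T A B e) :
    InjOn (extendAlong S T e e.source) A := by
  intro x hx y hy hxy
  obtain ⟨t, htx, hty⟩ := ((h.left_absorbed x hx).and (h.left_absorbed y hy)).exists
  have key : e (S t x) = e (S t y) := by
    rw [← h.extendAlong_eq_self htx, ← h.extendAlong_eq_self hty, h.extendAlong_apply t hx,
      h.extendAlong_apply t hy, hxy]
  rw [← h.left_neg_cancel t x, e.injOn htx hty key, h.left_neg_cancel]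

lemma left_neg_symm_mem (h : IsLocalConjugacy S T A B e) {y : Y} {t : ℝ} (ht : T t y ∈ e.target) :
    S (-t) (e.symm (T t y)) ∈ A :=
  h.left_mem _ _ (h.source_subset (e.map_target ht))

lemma extendAlong_left_neg_symm (h : IsLocalConjugacy S T A B e) {y : Y} {t : ℝ}
    (ht : T t y ∈ e.target) :
    extendAlong S T e e.source (S (-t) (e.symm (T t y))) = y := by
  have hs := e.map_target ht
  rw [h.extendAlong_apply _ (h.source_subset hs), h.extendAlong_eq_self hs, e.right_inv ht,
    h.right_neg_cancel]

/-- Any time at which the orbit is in the target of `e` computes the extension of `e.symm`. The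
hypothesis on `e` does not by itself make `e.symm` a local conjugacy, so this goes through the
injectivity of the extension of `e`. -/
lemma extendAlong_symm_eq (h : IsLocalConjugacy S T A B e) {y : Y} {t : ℝ}
    (ht : T t y ∈ e.target) :
    extendAlong T S e.symm e.target y = S (-t) (e.symm (T t y)) := by
  obtain ⟨s, hs, hy⟩ := exists_extendAlong_eq (T := S) (f := e.symm) ⟨t, ht⟩
  rw [hy]
  apply h.injOn_extendAlong (h.left_neg_symm_mem hs) (h.left_neg_symm_mem ht)
  rw [h.extendAlong_left_neg_symm hs, h.extendAlong_left_neg_symm ht]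

lemma extendAlong_symm_mem (h : IsLocalConjugacy S T A B e) {y : Y} (hy : y ∈ B) :
    extendAlong T S e.symm e.target y ∈ A := by
  obtain ⟨t, ht⟩ := (h.right_absorbed y hy).exists
  rw [h.extendAlong_symm_eq ht]
  exact h.left_neg_symm_mem ht

lemma extendAlong_extendAlong_symm (h : IsLocalConjugacy S T A B e) {y : Y} (hy : y ∈ B) :
    extendAlong S T e e.source (extendAlong T S e.symm e.target y) = y := by
  obtain ⟨t, ht⟩ := (h.right_absorbed y hy).exists
  rw [h.extendAlong_symm_eq ht, h.extendAlong_left_neg_symm ht]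

/-- The bijection between `A` and `B` obtained by extending `e` and `e.symm` along the actions. -/
noncomputable def globalize (h : IsLocalConjugacy S T A B e) : PartialEquiv X Y where
  toFun := extendAlong S T e e.source
  invFun := extendAlong T S e.symm e.target
  source := A
  target := B
  map_source' _ hx := h.extendAlong_mem hx
  map_target' _ hy := h.extendAlong_symm_mem hy
  left_inv' _ hx := h.injOn_extendAlong (h.extendAlong_symm_mem (h.extendAlong_mem hx)) hx
    (h.extendAlong_extendAlong_symm (h.extendAlong_mem hx))
  right_inv' _ hy := h.extendAlong_extendAlong_symm hy

end IsLocalConjugacy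

end Globalize

/-! ### The basin of attraction and its leaves -/

section Leaves

lemma apply_mem_stableManifold {Q : Type*} [TopologicalSpace Q] {Φ : Flow ℝ Q} {M : Set Q} {x : Q}
    (hx : x ∈ stableManifold Φ M) (s : ℝ) : Φ s x ∈ stableManifold Φ M := by
  have := Tendsto.comp hx (tendsto_atTop_add_const_right atTop s tendsto_id)
  refine this.congr fun t ↦ ?_
  simp [Φ.map_add]

variable {Q : Type*} [EMetricSpace Q] {Φ : Flow ℝ Q} {M : Set Q}

lemma neg_apply_apply (Φ : Flow ℝ Q) (s : ℝ) (x : Q) : Φ (-s) (Φ s x) = x := by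
  rw [← Φ.map_add, neg_add_cancel, Φ.map_zero_apply]

lemma apply_neg_apply (Φ : Flow ℝ Q) (s : ℝ) (x : Q) : Φ s (Φ (-s) x) = x := by
  rw [← Φ.map_add, add_neg_cancel, Φ.map_zero_apply]

lemma apply_mem_stableLeaf (hM : ∀ t : ℝ, ∀ m ∈ M, Φ t m ∈ M) {m x : Q}
    (hx : x ∈ stableLeaf Φ M m) (s : ℝ) : Φ s x ∈ stableLeaf Φ M (Φ s m) := by
  refine ⟨apply_mem_stableManifold hx.1 s, fun m' hm' hne ε hε ↦ ?_⟩
  have hne' : Φ (-s) m' ≠ m := by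
    rintro rfl
    exact hne (apply_neg_apply Φ s m').symm
  have := (tendsto_atTop_add_const_right atTop s tendsto_id).eventually
    (hx.2 _ (hM (-s) m' hm') hne' ε hε)
  filter_upwards [this] with t ht
  simpa [Φ.map_add, apply_neg_apply] using ht

/-- The flow permutes the leaves of the stable foliation. -/
lemma apply_mem_stableLeaf_iff (hM : ∀ t : ℝ, ∀ m ∈ M, Φ t m ∈ M) {m x : Q} (s : ℝ) :
    Φ s x ∈ stableLeaf Φ M (Φ s m) ↔ x ∈ stableLeaf Φ M m := by
  refine ⟨fun h ↦ ?_, fun h ↦ apply_mem_stableLeaf hM h s⟩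
  simpa only [neg_apply_apply] using apply_mem_stableLeaf hM h (-s)

lemma mem_stableManifold_of_mem (hM : ∀ t : ℝ, ∀ m ∈ M, Φ t m ∈ M) {m : Q} (hm : m ∈ M) :
    m ∈ stableManifold Φ M :=
  (tendsto_principal.2 (Eventually.of_forall fun t ↦ hM t m hm)).mono_right principal_le_nhdsSet

lemma self_mem_stableLeaf (hM : ∀ t : ℝ, ∀ m ∈ M, Φ t m ∈ M) {m : Q} (hm : m ∈ M) :
    m ∈ stableLeaf Φ M m :=
  ⟨mem_stableManifold_of_mem hM hm, fun _ _ _ _ _ ↦ Eventually.of_forall fun _ ↦ by simp⟩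

end Leaves

/-! ### The linear flow -/

section LinearFlow

variable {n : ℕ} {Q : Type*} [EMetricSpace Q]
  [ChartedSpace (EuclideanSpace ℝ (Fin n)) Q] {Φ : Flow ℝ Q}

lemma contMDiff_flow_apply {r : WithTop ℕ∞}
    (hΦ : ContMDiff (𝓘(ℝ, ℝ).prod (𝓡 n)) (𝓡 n) r (fun p : ℝ × Q ↦ Φ p.1 p.2)) (t : ℝ) :
    ContMDiff (𝓡 n) (𝓡 n) r (Φ t) :=
  hΦ.comp (contMDiff_const.prodMk contMDiff_id)

lemma tangentMap_flow_zero (p : TangentBundle (𝓡 n) Q) :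
    tangentMap (𝓡 n) (𝓡 n) (Φ 0) p = p := by
  rw [Φ.map_zero, tangentMap_id, id]

lemma tangentMap_flow_add (hΦ : ∀ t, MDifferentiable (𝓡 n) (𝓡 n) (Φ t)) (s t : ℝ)
    (p : TangentBundle (𝓡 n) Q) :
    tangentMap (𝓡 n) (𝓡 n) (Φ (s + t)) p =
      tangentMap (𝓡 n) (𝓡 n) (Φ s) (tangentMap (𝓡 n) (𝓡 n) (Φ t) p) := by
  have : Φ (s + t) = Φ s ∘ Φ t := funext (Φ.map_add s t)
  rw [this, tangentMap_comp (hΦ s) (hΦ t), Function.comp_apply]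

variable [IsManifold (𝓡 n) ∞ Q] [RiemannianBundle (fun q : Q ↦ TangentSpace (𝓡 n) q)]
  [IsContinuousRiemannianBundle (EuclideanSpace ℝ (Fin n)) (fun q : Q ↦ TangentSpace (𝓡 n) q)]
  {M : Set Q}

/-- Over a compact set, each neighbourhood of the zero section contains a tube of uniform radius
for the Riemannian norm. -/
lemma exists_forall_norm_lt_mem_of_mem_nhdsSet_zeroSectionOver (hM : IsCompact M)
    {V : Set (TangentBundle (𝓡 n) Q)} (hV : V ∈ 𝓝ˢ (zeroSectionOver (n := n) M)) :
    ∃ ε > 0, ∀ m ∈ M, ∀ v : TangentSpace (𝓡 n) m, ‖v‖ < ε →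
      (⟨m, v⟩ : TangentBundle (𝓡 n) Q) ∈ V := by
  suffices hloc : ∀ m ∈ M, ∃ ε > 0, ∀ᶠ q in 𝓝 m, ∀ v : TangentSpace (𝓡 n) q, ‖v‖ < ε →
      (⟨q, v⟩ : TangentBundle (𝓡 n) Q) ∈ V by
    refine hM.induction_on (p := fun s ↦ ∃ ε > 0, ∀ m ∈ s, ∀ v : TangentSpace (𝓡 n) m, ‖v‖ < ε →
      (⟨m, v⟩ : TangentBundle (𝓡 n) Q) ∈ V) ⟨1, one_pos, by simp⟩ ?_ ?_ ?_
    · rintro s t hst ⟨ε, hε, h⟩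
      exact ⟨ε, hε, fun m hm ↦ h m (hst hm)⟩
    · rintro s t ⟨ε, hε, h⟩ ⟨δ, hδ, h'⟩
      refine ⟨min ε δ, lt_min hε hδ, ?_⟩
      rintro m (hm | hm) v hv
      · exact h m hm v (hv.trans_le (min_le_left _ _))
      · exact h' m hm v (hv.trans_le (min_le_right _ _))
    · intro m hm
      obtain ⟨ε, hε, h⟩ := hloc m hm
      exact ⟨_, mem_nhdsWithin_of_mem_nhds h, ε, hε, fun q hq ↦ hq⟩
  intro m hm
  let e := trivializationAt (EuclideanSpace ℝ (Fin n)) (fun q : Q ↦ TangentSpace (𝓡 n) q) m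
  have hmb : m ∈ e.baseSet := mem_baseSet_trivializationAt _ _ m
  have hz : (⟨m, 0⟩ : TangentBundle (𝓡 n) Q) ∈ zeroSectionOver (n := n) M := ⟨hm, rfl⟩
  have hVm : V ∈ 𝓝 (⟨m, 0⟩ : TangentBundle (𝓡 n) Q) := mem_nhdsSet_iff_forall.1 hV _ hz
  have hread {q : Q} (hq : q ∈ e.baseSet) (v : TangentSpace (𝓡 n) q) :
      e.toOpenPartialHomeomorph.symm (q, e.continuousLinearMapAt ℝ q v) =
        (⟨q, v⟩ : TangentBundle (𝓡 n) Q) := by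
    have := e.toOpenPartialHomeomorph.left_inv (x := (⟨q, v⟩ : TangentBundle (𝓡 n) Q))
      (e.mem_source.2 hq)
    rwa [e.coe_coe, e.apply_eq_prod_continuousLinearEquivAt ℝ q hq v,
      e.coe_continuousLinearEquivAt_eq hq] at this
  -- The neighbourhood is read in a trivialization, where it contains a product set.
  have hsymm : ∀ᶠ p in 𝓝 ((m, 0) : Q × EuclideanSpace ℝ (Fin n)),
      e.toOpenPartialHomeomorph.symm p ∈ V := by
    have hmt : ((m, 0) : Q × EuclideanSpace ℝ (Fin n)) ∈ e.target := e.mem_target.2 hmb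
    have hc := e.toOpenPartialHomeomorph.continuousAt_symm hmt
    apply hc
    have h0 := hread hmb 0
    rw [map_zero] at h0
    rwa [h0]
  rw [nhds_prod_eq] at hsymm
  obtain ⟨pa, hpa, pb, hpb, hab⟩ := eventually_prod_iff.1 hsymm
  obtain ⟨δ, hδ, hball⟩ := Metric.eventually_nhds_iff.1 hpb
  obtain ⟨C, hC, hnorm⟩ := eventually_norm_trivializationAt_lt (EuclideanSpace ℝ (Fin n))
    (fun q : Q ↦ TangentSpace (𝓡 n) q) m
  refine ⟨δ / C, div_pos hδ hC, ?_⟩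
  filter_upwards [hpa, hnorm, e.open_baseSet.mem_nhds hmb] with q hq hqC hqb v hv
  have hsmall : ‖e.continuousLinearMapAt ℝ q v‖ < δ := by
    calc ‖e.continuousLinearMapAt ℝ q v‖ ≤ C * ‖v‖ :=
          (ContinuousLinearMap.le_opNorm _ v).trans
            (mul_le_mul_of_nonneg_right hqC.le (norm_nonneg v))
      _ < δ := by rwa [mul_comm, ← lt_div_iff₀ hC]
  have hmem := hab hq (hball (by rwa [dist_zero_right]))
  rwa [hread hqb v] at hmem

/-- The linear flow contracts the stable bundle to the zero section. -/
lemma IsNAIM.eventually_tangentMap_mem {r d : ℕ}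
    {Es : (q : Q) → Submodule ℝ (TangentSpace (𝓡 n) q)} (hM : IsNAIM r d Φ M Es)
    {V : Set (TangentBundle (𝓡 n) Q)} (hV : V ∈ 𝓝ˢ (zeroSectionOver (n := n) M))
    {p : TangentBundle (𝓡 n) Q} (hp : p ∈ totalSet M Es) :
    ∀ᶠ t in atTop, tangentMap (𝓡 n) (𝓡 n) (Φ t) p ∈ V := by
  obtain ⟨ε, hε, htube⟩ :=
    exists_forall_norm_lt_mem_of_mem_nhdsSet_zeroSectionOver hM.isCompact hV
  obtain ⟨C, -, a, ha, hrate⟩ := hM.rates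
  have hlim : Tendsto (fun t : ℝ ↦ C * Real.exp (a * t) * ‖p.2‖) atTop (𝓝 0) := by
    have : Tendsto (fun t : ℝ ↦ Real.exp (a * t)) atTop (𝓝 0) :=
      Real.tendsto_exp_atBot.comp (tendsto_id.const_mul_atTop_of_neg ha)
    simpa using (this.const_mul C).mul_const ‖p.2‖
  filter_upwards [hlim.eventually_lt_const hε, eventually_ge_atTop 0] with t ht ht0
  refine htube _ (hM.invariant t _ hp.1) _ (lt_of_le_of_lt ?_ ht)
  simpa using hrate 0 (Nat.zero_le r) t ht0 p.1 hp.1 p.2 hp.2 0 (zero_mem _)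

end LinearFlow

end NAIM

/-! ### The global linearization -/

theorem mainTheorem3 {n : ℕ} {Q : Type*} [EMetricSpace Q]
    [ChartedSpace (EuclideanSpace ℝ (Fin n)) Q] [IsManifold (𝓡 n) ∞ Q]
    [RiemannianBundle (fun q : Q ↦ TangentSpace (𝓡 n) q)]
    [IsContMDiffRiemannianBundle (𝓡 n) ∞ (EuclideanSpace ℝ (Fin n))
      (fun q : Q ↦ TangentSpace (𝓡 n) q)]
    [IsRiemannianManifold (𝓡 n) Q]
    (r k : ℕ∞) (hkr : k + 1 ≤ r)
    (Φ : Flow ℝ Q)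
    (hΦ : ContMDiff (𝓘(ℝ, ℝ).prod (𝓡 n)) (𝓡 n) (r : WithTop ℕ∞) (fun p : ℝ × Q ↦ Φ p.1 p.2))
    (d : ℕ) (M : Set Q) (Es : (q : Q) → Submodule ℝ (TangentSpace (𝓡 n) q))
    (hM : NAIM.IsNAIM 1 d Φ M Es)
    (hEs : NAIM.IsSubbundle k M Es)
    (ρ : Q → Q) (φloc : PartialEquiv Q (TangentBundle (𝓡 n) Q))
    (hφloc : NAIM.IsLinearizingConjugacy k Φ M Es ρ φloc)
    (hsource : φloc.source ∈ 𝓝ˢ M)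
    (htarget : φloc.target ∈ 𝓝ˢ (NAIM.zeroSectionOver M) ⊓ 𝓟 (NAIM.totalSet M Es)) :
    ∃ φ : PartialEquiv Q (TangentBundle (𝓡 n) Q),
      φ.source = NAIM.stableManifold Φ M ∧
      φ.target = NAIM.totalSet M Es ∧
      NAIM.IsLinearizingConjugacy k Φ M Es ρ φ ∧
      (∀ (t : ℝ), ∀ x ∈ NAIM.stableManifold Φ M,
        φ (Φ t x) = tangentMap (𝓡 n) (𝓡 n) (Φ t) (φ x)) ∧
      EqOn φ φloc φloc.source := by
  have hkr' : (k : WithTop ℕ∞) + 1 ≤ (r : WithTop ℕ∞) := by exact_mod_cast hkr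
  have hk1 : (k : WithTop ℕ∞) ≤ (r : WithTop ℕ∞) := le_self_add.trans hkr'
  have h1r : (1 : WithTop ℕ∞) ≤ (r : WithTop ℕ∞) := le_add_self.trans hkr'
  have hflow (t : ℝ) : ContMDiff (𝓡 n) (𝓡 n) (k : WithTop ℕ∞) (Φ t) :=
    (NAIM.contMDiff_flow_apply hΦ t).of_le hk1
  have hdiff (t : ℝ) : MDifferentiable (𝓡 n) (𝓡 n) (Φ t) :=
    (NAIM.contMDiff_flow_apply hΦ t).mdifferentiable (one_pos.trans_le h1r).ne'
  have htangent (t : ℝ) : ContMDiff (𝓡 n).tangent (𝓡 n).tangent (k : WithTop ℕ∞)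
      (tangentMap (𝓡 n) (𝓡 n) (Φ t)) :=
    (NAIM.contMDiff_flow_apply hΦ t).contMDiff_tangentMap hkr'
  have : IsContinuousRiemannianBundle (EuclideanSpace ℝ (Fin n))
      (fun q : Q ↦ TangentSpace (𝓡 n) q) := by
    obtain ⟨g, hg, hinner⟩ := IsContMDiffRiemannianBundle.exists_contMDiff (IB := 𝓡 n) (n := ∞)
      (F := EuclideanSpace ℝ (Fin n)) (E := fun q : Q ↦ TangentSpace (𝓡 n) q)
    exact ⟨g, hg.continuous, hinner⟩
  -- Orbits enter the open sets `U` and `V`, so that one time serves a neighbourhood of a given point.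
  obtain ⟨U, hUo, hMU, hUs⟩ := mem_nhdsSet_iff_exists.1 hsource
  obtain ⟨V, hVo, hZV, hVE⟩ := mem_nhdsSet_iff_exists.1 (mem_inf_principal.1 htarget)
  have hinv (t : ℝ) : ∀ p ∈ NAIM.totalSet M Es,
      tangentMap (𝓡 n) (𝓡 n) (Φ t) p ∈ NAIM.totalSet M Es := fun p hp ↦
    ⟨hM.invariant t _ hp.1, hM.bundle_invariant t _ hp.1 _ hp.2⟩
  have hU : ∀ x ∈ NAIM.stableManifold Φ M, ∀ᶠ t in atTop, Φ t x ∈ U := fun x hx ↦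
    hx (hUo.mem_nhdsSet.2 hMU)
  have hV : ∀ p ∈ NAIM.totalSet M Es, ∀ᶠ t in atTop, tangentMap (𝓡 n) (𝓡 n) (Φ t) p ∈ V :=
    fun p hp ↦ hM.eventually_tangentMap_mem (hVo.mem_nhdsSet.2 hZV) hp
  have hVt : ∀ p ∈ NAIM.totalSet M Es, p ∈ V → p ∈ φloc.target := fun p hp hpV ↦ hVE hpV hp
  have h : NAIM.IsLocalConjugacy (fun t ↦ Φ t) (fun t ↦ tangentMap (𝓡 n) (𝓡 n) (Φ t))
      (NAIM.stableManifold Φ M) (NAIM.totalSet M Es) φloc :=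
    { left_zero := Φ.map_zero_apply
      left_add := Φ.map_add
      right_zero := NAIM.tangentMap_flow_zero
      right_add := NAIM.tangentMap_flow_add hdiff
      source_subset := hφloc.source_subset
      target_subset := hφloc.target_subset
      left_mem := fun t x hx ↦ NAIM.apply_mem_stableManifold hx t
      right_mem := hinv
      left_absorbed := fun x hx ↦ (hU x hx).mono fun t ht ↦ hUs ht
      right_absorbed := fun p hp ↦ (hV p hp).mono fun t ht ↦ hVt _ (hinv t p hp) ht
      conj := hφloc.conjugates }
  refine ⟨h.globalize, rfl, rfl, ⟨subset_rfl, subset_rfl, ?_, ?_, ?_, ?_⟩, ?_, ?_⟩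
  · intro x hx
    obtain ⟨t, ht⟩ := (hU x hx).exists
    have hnear : ∀ᶠ y in 𝓝[NAIM.stableManifold Φ M] x, Φ t y ∈ φloc.source :=
      mem_nhdsWithin_of_mem_nhds (mem_of_superset ((hUo.preimage (hflow t).continuous).mem_nhds ht)
        fun y hy ↦ hUs hy)
    have hloc : ContMDiffWithinAt (𝓡 n) (𝓡 n).tangent (k : WithTop ℕ∞)
        (fun y ↦ tangentMap (𝓡 n) (𝓡 n) (Φ (-t)) (φloc (Φ t y))) (Φ t ⁻¹' φloc.source) x :=
      (htangent (-t)).contMDiffAt.comp_contMDiffWithinAt x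
        ((hφloc.contMDiffOn (Φ t x) (hUs ht)).comp x (hflow t).contMDiffAt.contMDiffWithinAt fun y hy ↦ hy)
    refine (hloc.mono_of_mem_nhdsWithin hnear).congr_of_eventuallyEq ?_ ?_
    · filter_upwards [hnear] with y hy using h.extendAlong_eq hy
    · exact h.extendAlong_eq (hUs ht)
  · intro p hp
    obtain ⟨t, ht⟩ := (hV p hp).exists
    have hnear : ∀ᶠ q in 𝓝[NAIM.totalSet M Es] p,
        tangentMap (𝓡 n) (𝓡 n) (Φ t) q ∈ φloc.target := by
      filter_upwards [mem_nhdsWithin_of_mem_nhds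
        ((hVo.preimage (htangent t).continuous).mem_nhds ht), self_mem_nhdsWithin] with q hq hq'
      exact hVt _ (hinv t q hq') hq
    have htp := hVt _ (hinv t p hp) ht
    have hloc : ContMDiffWithinAt (𝓡 n).tangent (𝓡 n) (k : WithTop ℕ∞)
        (fun q ↦ Φ (-t) (φloc.symm (tangentMap (𝓡 n) (𝓡 n) (Φ t) q)))
        (tangentMap (𝓡 n) (𝓡 n) (Φ t) ⁻¹' φloc.target) p :=
      (hflow (-t)).contMDiffAt.comp_contMDiffWithinAt p
        ((hφloc.contMDiffOn_symm _ htp).comp p (htangent t).contMDiffAt.contMDiffWithinAt fun y hy ↦ hy)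
    refine (hloc.mono_of_mem_nhdsWithin hnear).congr_of_eventuallyEq ?_ ?_
    · filter_upwards [hnear] with q hq using h.extendAlong_symm_eq hq
    · exact h.extendAlong_symm_eq htp
  · intro m hm x hx
    have hρ : ∀ m ∈ M, (φloc m).1 = ρ m := fun m hm ↦
      (hφloc.fiber_preserving m hm m (hUs (hMU hm))).1 (NAIM.self_mem_stableLeaf hM.invariant hm)
    have hρΦ (t : ℝ) : ρ (Φ t m) = Φ t (ρ m) := by
      rw [← hρ _ (hM.invariant t m hm), ← hρ m hm, hφloc.conjugates t m (hUs (hMU hm))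
        (hUs (hMU (hM.invariant t m hm)))]
      rfl
    obtain ⟨t, ht⟩ := (hU x hx).exists
    have hbase : (h.globalize x).1 = Φ (-t) (φloc (Φ t x)).1 :=
      congrArg TotalSpace.proj (h.extendAlong_eq (hUs ht))
    rw [hbase, ← NAIM.apply_mem_stableLeaf_iff hM.invariant t,
      hφloc.fiber_preserving _ (hM.invariant t m hm) _ (hUs ht), hρΦ]
    constructor
    · intro heq
      rw [heq, NAIM.neg_apply_apply]
    · intro heq
      rw [← heq, NAIM.apply_neg_apply]
  · exact fun t x hx _ ↦ h.extendAlong_apply t hx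
  · exact fun t x hx ↦ h.extendAlong_apply t hx
  · exact fun x hx ↦ h.extendAlong_eq_self hx
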